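/- Let $h\ge 0$ be an integer, $m=2h+1$, $q=3^{m}$ and $\alpha=3^{h+1}$. Let $\operatorname{Tr}$ denote the absolute trace from $\mathbb F_q$ to $\mathbb F_3$, let $\chi$ be the (multiplicative) quadratic character of $\mathbb F_q$, and let $\xi_3=e^{2\pi i/3}$. Then for any $\beta,a\in\mathbb F_q^*$, $$\sum_{x\in\mathbb F_q^*}\chi(x)\,\xi_3^{\operatorname{Tr}\left(x^{\alpha+2}+(\beta^{\alpha-1}a^{\alpha}-\beta^{2(\alpha-1)}a^{2\alpha})x\right)}=\pm\sqrt{-q},$$ that is, the sum equals $i\sqrt q$ or $-i\sqrt q$. -/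

import Mathlib

/-!
For an odd permutation `f` of `F` let `T γ = ∑ x, χ x * t (γ * f x)`, where `t` is the trace lifted
to `{-1, 0, 1}`. Since `q % 4 = 3`, the quadratic character `χ` is odd, so the character sum of
`γ * f` is `(i √3 / 2) * T γ`, and orthogonality of the additive characters gives
`∑ γ, T γ ^ 2 = 4 * q * (q - 1) / 3`. Pairing `x` with `-x` gives `T γ ≡ 2 [ZMOD 4]` for `γ ≠ 0`.
If moreover `3 ^ h ∣ T γ` for all `γ`, then `|T γ| ≥ 2 * 3 ^ h` for each of the `q - 1` nonzero `γ`,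
and the second moment forces equality throughout.

The sum in question is that of `f x = x ^ (2 * α + 3) + (b * x) ^ α - b ^ 2 * x` with
`b = β ^ (α - 1) * a ^ α`, because `f x` has the same trace as `x ^ (α + 2) + (b - b ^ 2) * x`. That
`f` is injective is an elimination argument in the automorphism `x ↦ x ^ α`, whose square is cubing.

For the divisibility, work in the Witt vectors of `F` with the Teichmüller lift `τ`. There
`χ x = τ x ^ ((q - 1) / 2)`, and the lifted trace of `γ * f x` is, modulo a high power of `3`, a
combination of terms `3 ^ r * τ x ^ N`, where `N` is a sum of `2 * r + 1` exponents `3 ^ i * e` with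
`e ∈ {α + 2, 1}`. Summing over `x` kills such a term unless `q - 1 ∣ (q - 1) / 2 + N`, and counting
the carries in base `3` shows that this congruence needs `2 * r + 1 ≥ 2 * h + 1`.
-/

section CyclicDigits

variable {b : ℤ} {n : ℕ} [NeZero n]

variable (b) in
/-- The base-`b` value `∑ i, f i * b ^ i` of a family `f` of integer digits. The positions are
indexed by `ZMod n` because only values modulo `b ^ n - 1` matter, and there multiplication by `b`
is a rotation of the digits. -/
def digitValue : (ZMod n → ℤ) →ₗ[ℤ] ℤ :=
  Fintype.linearCombination ℤ fun i => b ^ i.val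

theorem mul_digitValue_rotate (f : ZMod n → ℤ) :
    b * digitValue b (fun i => f (i + 1)) = digitValue b f + (b ^ n - 1) * f 0 := by
  obtain _ | n := n
  · exact absurd rfl (NeZero.ne 0)
  have key (g : Fin (n + 1) → ℤ) : b * ∑ i, g (i + 1) * b ^ (i : ℕ) =
      ∑ i, g i * b ^ (i : ℕ) + (b ^ (n + 1) - 1) * g 0 := by
    rw [Fin.sum_univ_castSucc, Fin.sum_univ_succ (f := fun i => g i * b ^ (i : ℕ))]
    simp only [Fin.coeSucc_eq_succ, Fin.last_add_one, Fin.val_castSucc, Fin.val_last,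
      Fin.val_succ, Fin.val_zero, pow_succ', mul_add, Finset.mul_sum, mul_left_comm b]
    ring
  exact key f

theorem sub_one_mul_digitValue_one : (b - 1) * digitValue b (1 : ZMod n → ℤ) = b ^ n - 1 := by
  have h := mul_digitValue_rotate (b := b) (1 : ZMod n → ℤ)
  simp only [Pi.one_apply, ← Pi.one_def] at h
  linear_combination h

theorem digitValue_rotate_modEq (f : ZMod n → ℤ) (t : ℕ) :
    digitValue b (fun i => f (i - (t : ZMod n))) ≡ b ^ t * digitValue b f [ZMOD b ^ n - 1] := by
  induction t with
  | zero => simp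
  | succ t ih =>
    have hstep : digitValue b (fun i => f (i - ((t + 1 : ℕ) : ZMod n))) ≡
        b * digitValue b (fun i => f (i - (t : ZMod n))) [ZMOD b ^ n - 1] := by
      have h := mul_digitValue_rotate (b := b) fun i => f (i - ((t + 1 : ℕ) : ZMod n))
      simp only [Nat.cast_succ, add_sub_add_right_eq_sub] at h ⊢
      exact Int.modEq_iff_dvd.2 ⟨_, by rw [h, add_sub_cancel_left]⟩
    rw [pow_succ', mul_assoc]
    exact hstep.trans (ih.mul_left b)

theorem digitValue_single_natCast_modEq (t : ℕ) :
    digitValue b (Pi.single (t : ZMod n) 1) ≡ b ^ t [ZMOD b ^ n - 1] := by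
  have hrot : (Pi.single (t : ZMod n) 1 : ZMod n → ℤ) =
      fun i => (Pi.single 0 1 : ZMod n → ℤ) (i - t) := by
    funext i
    simp only [Pi.single_apply, sub_eq_zero]
  have hzero : digitValue b (Pi.single 0 1 : ZMod n → ℤ) = 1 := by simp [digitValue]
  simpa only [← hrot, hzero, mul_one] using
    digitValue_rotate_modEq (b := b) (Pi.single (0 : ZMod n) 1) t

theorem digitValue_single_add_one_modEq (a : ZMod n) :
    digitValue b (Pi.single (a + 1) 1) ≡ b * digitValue b (Pi.single a 1) [ZMOD b ^ n - 1] := by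
  have h := digitValue_single_natCast_modEq (b := b) (n := n) (a.val + 1)
  have ha := digitValue_single_natCast_modEq (b := b) (n := n) a.val
  rw [Nat.cast_succ, ZMod.natCast_zmod_val, pow_succ'] at h
  rw [ZMod.natCast_zmod_val] at ha
  exact h.trans (ha.symm.mul_left b)

theorem exists_cyclic_carries (hb : 1 < b) {D : ZMod n → ℤ} (hD : b ^ n - 1 ∣ digitValue b D) :
    ∃ c : ZMod n → ℤ, ∀ i, b * c i = D i + c (i - 1) := by
  have hdvd (i : ZMod n) : b ^ n - 1 ∣ digitValue b (fun l => D (l + i)) := by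
    have h := digitValue_rotate_modEq (b := b) D (-i).val
    simp only [ZMod.natCast_zmod_val, sub_neg_eq_add] at h
    exact h.dvd_iff.2 (hD.mul_left _)
  choose c hc using hdvd
  refine ⟨fun i => c (i + 1), fun i => ?_⟩
  have hne : b ^ n - 1 ≠ 0 := (sub_pos.2 (one_lt_pow₀ hb (NeZero.ne n))).ne'
  have h := mul_digitValue_rotate (b := b) fun l => D (l + i)
  simp only [add_right_comm _ 1 i, zero_add] at h
  simp only [add_assoc, hc] at h
  refine mul_left_cancel₀ hne ?_
  simp only [sub_add_cancel]
  linear_combination h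

theorem sub_one_mul_sum_carries {c D : ZMod n → ℤ} (hc : ∀ i, b * c i = D i + c (i - 1)) :
    (b - 1) * ∑ i, c i = ∑ i, D i := by
  have hsum := Finset.sum_congr rfl fun i (_ : i ∈ Finset.univ) => hc i
  have hrot : ∑ i, c (i - 1) = ∑ i, c i := (Equiv.subRight 1).sum_comp c
  rw [← Finset.mul_sum, Finset.sum_add_distrib, hrot] at hsum
  linear_combination hsum

theorem carries_nonneg (hb : 1 < b) {c D : ZMod n → ℤ} (hD : ∀ i, 1 - b < D i)
    (hc : ∀ i, b * c i = D i + c (i - 1)) : ∀ i, 0 ≤ c i := by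
  obtain ⟨i₀, hmin⟩ := Finite.exists_min c
  have hpos : 0 < (b - 1) * (c i₀ + 1) := by linarith [hc i₀, hmin (i₀ - 1), hD i₀]
  have hc₀ : 0 < c i₀ + 1 := pos_of_mul_pos_right hpos (by linarith)
  exact fun i => (Int.lt_add_one_iff.1 hc₀).trans (hmin i)

theorem exists_reduced_digits (hb : 1 < b) {j : ZMod n → ℤ} (hj : 0 ≤ j) :
    ∃ j' : ZMod n → ℤ, 0 ≤ j' ∧ (∀ i, j' i < b) ∧ ∑ i, j' i ≤ ∑ i, j i ∧
      digitValue b j' ≡ digitValue b j [ZMOD b ^ n - 1] := by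
  induction hs : (∑ i, j i).toNat using Nat.strong_induction_on generalizing j with
  | _ s ih =>
    by_cases hlt : ∀ i, j i < b
    · exact ⟨j, hj, hlt, le_rfl, Int.ModEq.rfl⟩
    push Not at hlt
    obtain ⟨a, ha⟩ := hlt
    set g : ZMod n → ℤ := j - b • Pi.single a 1 + Pi.single (a + 1) 1 with hg
    have hg0 : 0 ≤ g := by
      refine add_nonneg (sub_nonneg.2 fun i => ?_) (Pi.single_nonneg.2 zero_le_one)
      rcases eq_or_ne i a with rfl | hi
      · simpa using ha
      · simpa [hi] using hj i
    have hsum : ∑ i, g i = ∑ i, j i - b + 1 := by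
      simp [hg, Finset.sum_add_distrib, ← Finset.mul_sum]
    have hval : digitValue b g ≡ digitValue b j [ZMOD b ^ n - 1] := by
      rw [hg, map_add, map_sub, map_smul, smul_eq_mul]
      simpa using (digitValue_single_add_one_modEq (b := b) a).add_left
        (digitValue b j - b * digitValue b (Pi.single a 1))
    have hpos : 0 ≤ ∑ i, g i := Finset.sum_nonneg fun i _ => hg0 i
    obtain ⟨j', h0, hlt, hle, hmod⟩ := ih (∑ i, g i).toNat (by omega) hg0 rfl
    exact ⟨j', h0, hlt, by omega, hmod.trans hval⟩

end CyclicDigits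

section FrobeniusMultiples

open scoped Pointwise

/-- The exponents `p ^ i * e` with `e ∈ E`. Its `d`-fold sumset `d • frobeniusMultiples p E`
consists of the exponents of the products of `d` monomials, each of which is an iterated `p`-th
power of some `X ^ e` with `e ∈ E`. -/
def frobeniusMultiples (p : ℕ) (E : Set ℕ) : Set ℕ :=
  {N | ∃ i, ∃ e ∈ E, N = p ^ i * e}

theorem mul_mem_nsmul_frobeniusMultiples {p d N : ℕ} {E : Set ℕ}
    (hN : N ∈ d • frobeniusMultiples p E) : p * N ∈ d • frobeniusMultiples p E := by
  induction d generalizing N with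
  | zero =>
    rw [zero_nsmul, Set.mem_zero] at hN ⊢
    simp [hN]
  | succ d ih =>
    rw [succ_nsmul] at hN ⊢
    obtain ⟨M, hM, _, ⟨i, e, he, rfl⟩, rfl⟩ := hN
    exact ⟨p * M, ih hM, p * (p ^ i * e), ⟨i + 1, e, he, by ring⟩, (mul_add _ _ _).symm⟩

theorem exists_digits_of_mem_nsmul_frobeniusMultiples {p n : ℕ} [NeZero n] {e₁ e₂ d N : ℕ}
    (hN : N ∈ d • frobeniusMultiples p {e₁, e₂}) :
    ∃ j k : ZMod n → ℤ, 0 ≤ j ∧ 0 ≤ k ∧ ∑ i, j i + ∑ i, k i = d ∧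
      (N : ℤ) ≡ e₁ * digitValue p j + e₂ * digitValue p k [ZMOD p ^ n - 1] := by
  induction d generalizing N with
  | zero =>
    rw [zero_nsmul, Set.mem_zero] at hN
    exact ⟨0, 0, le_rfl, le_rfl, by simp, by simp [hN]⟩
  | succ d ih =>
    rw [succ_nsmul] at hN
    obtain ⟨M, hM, _, ⟨i, e, he, rfl⟩, rfl⟩ := hN
    obtain ⟨j, k, hj, hk, hsum, hmod⟩ := ih hM
    have hadd {f : ZMod n → ℤ} (hf : 0 ≤ f) : 0 ≤ f + Pi.single (i : ZMod n) 1 :=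
      add_nonneg hf (Pi.single_nonneg.2 zero_le_one)
    have hsum_add (f : ZMod n → ℤ) : ∑ l, (f + Pi.single (i : ZMod n) 1 : ZMod n → ℤ) l =
        ∑ l, f l + 1 := by
      simp [Finset.sum_add_distrib]
    have hterm := (digitValue_single_natCast_modEq (b := p) (n := n) i).symm.mul_left e
    rcases he with rfl | rfl
    · refine ⟨j + Pi.single (i : ZMod n) 1, k, hadd hj, hk, ?_, ?_⟩
      · rw [hsum_add]
        push_cast
        linarith
      · convert hmod.add hterm using 1
        · push_cast; ring
        · rw [map_add]; ring
    · refine ⟨j, k + Pi.single (i : ZMod n) 1, hj, hadd hk, ?_, ?_⟩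
      · rw [hsum_add]
        push_cast
        linarith
      · convert hmod.add hterm using 1
        · push_cast; ring
        · rw [map_add]; ring

-- With `s = j (i - (h + 1)) + c (i - 1)` and `d = c (i - (h + 1))`, position `i` sends the state
-- `(s, d)` to the state `(j i + d, c i)` of position `i + (h + 1)`. The potential `φ` is minus the
-- largest total of `j i - c i` along a path that starts at a given state, which is `0` or `1`.
theorem sum_digits_le_sum_carries (h : ℕ) {j k c : ZMod (2 * h + 1) → ℤ}
    (hj₀ : ∀ i, 0 ≤ j i) (hj₃ : ∀ i, j i < 3) (hk : ∀ i, 0 ≤ k i)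
    (hc : ∀ i, 3 * c i = (j (i - (h + 1 : ℕ)) + 2 * j i + k i - 1) + c (i - 1)) :
    ∑ i, j i ≤ ∑ i, c i := by
  have hc₀ : ∀ i, 0 ≤ c i := carries_nonneg (by norm_num)
    (fun i => by linarith [hj₀ (i - (h + 1 : ℕ)), hj₀ i, hk i]) hc
  let P (s d : ℤ) : ℤ := if s = 0 ∨ 2 * s + d ≤ 4 then -1 else 0
  let φ (i : ZMod (2 * h + 1)) : ℤ := P (j (i - (h + 1 : ℕ)) + c (i - 1)) (c (i - (h + 1 : ℕ)))
  have hstep (i) : φ i - φ (i + (h + 1 : ℕ)) ≤ c i - j i := by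
    have hz : ((2 * h + 1 : ℕ) : ZMod (2 * h + 1)) = 0 := ZMod.natCast_self _
    have hprev : i + ((h + 1 : ℕ) : ZMod (2 * h + 1)) - 1 = i - (h + 1 : ℕ) := by
      push_cast at hz ⊢
      linear_combination hz
    simp only [φ, P, hprev, add_sub_cancel_right]
    have := hc i
    have := hk i
    have := hj₃ i
    have := hj₀ i
    have := hj₃ (i - (h + 1 : ℕ))
    have := hj₀ (i - (h + 1 : ℕ))
    have := hc₀ i
    have := hc₀ (i - 1)
    have := hc₀ (i - (h + 1 : ℕ))
    split_ifs <;> omega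
  have hcycle : ∑ i, φ (i + (h + 1 : ℕ)) = ∑ i, φ i :=
    Equiv.sum_comp (Equiv.addRight ((h + 1 : ℕ) : ZMod (2 * h + 1))) φ
  have hsum := Finset.sum_le_sum fun i (_ : i ∈ Finset.univ) => hstep i
  rw [Finset.sum_sub_distrib, Finset.sum_sub_distrib, hcycle] at hsum
  linarith

theorem card_digits_le_sum_digits (h : ℕ) {j k : ZMod (2 * h + 1) → ℤ} (hj : 0 ≤ j) (hk : 0 ≤ k)
    (hjk : (3 ^ (h + 1) + 2) * digitValue 3 j + digitValue 3 k ≡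
      digitValue 3 (1 : ZMod (2 * h + 1) → ℤ) [ZMOD 3 ^ (2 * h + 1) - 1]) :
    (2 * h + 1 : ℤ) ≤ ∑ i, j i + ∑ i, k i := by
  obtain ⟨j', hj'₀, hj'₃, hle, hmod⟩ := exists_reduced_digits (b := 3) (by norm_num) hj
  let s : ZMod (2 * h + 1) → ℤ := fun i => j' (i - (h + 1 : ℕ))
  have hs : digitValue 3 s ≡ 3 ^ (h + 1) * digitValue 3 j [ZMOD 3 ^ (2 * h + 1) - 1] :=
    (digitValue_rotate_modEq j' (h + 1)).trans (hmod.mul_left _)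
  have hD : (3 ^ (2 * h + 1) - 1 : ℤ) ∣ digitValue 3 (s + (2 : ℤ) • j' + k - 1) := by
    rw [map_sub, map_add, map_add, map_smul, smul_eq_mul]
    rw [add_mul] at hjk
    exact (((hs.add (hmod.mul_left 2)).add_right _).trans hjk).symm.dvd
  obtain ⟨c, hc⟩ := exists_cyclic_carries (by norm_num) hD
  have hjc : ∑ i, j' i ≤ ∑ i, c i := sum_digits_le_sum_carries h hj'₀ hj'₃ hk hc
  have hsum : 2 * ∑ i, c i = 3 * ∑ i, j' i + ∑ i, k i - (2 * h + 1) := by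
    have hrot : ∑ i, s i = ∑ i, j' i :=
      (Equiv.subRight ((h + 1 : ℕ) : ZMod (2 * h + 1))).sum_comp j'
    have := sub_one_mul_sum_carries hc
    simp only [Pi.sub_apply, Pi.add_apply, Pi.smul_apply, Pi.one_apply, smul_eq_mul,
      Finset.sum_sub_distrib, Finset.sum_add_distrib, ← Finset.mul_sum, hrot, Finset.sum_const,
      Finset.card_univ, ZMod.card, nsmul_eq_mul] at this
    push_cast at this
    linarith
  linarith

theorem le_of_mem_nsmul_frobeniusMultiples {h d N : ℕ}
    (hN : N ∈ d • frobeniusMultiples 3 {3 ^ (h + 1) + 2, 1})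
    (hdvd : 3 ^ (2 * h + 1) - 1 ∣ 3 ^ (2 * h + 1) / 2 + N) : 2 * h + 1 ≤ d := by
  obtain ⟨j, k, hj, hk, hsum, hmod⟩ :=
    exists_digits_of_mem_nsmul_frobeniusMultiples (n := 2 * h + 1) hN
  have hhalf : ((3 ^ (2 * h + 1) / 2 : ℕ) : ℤ) = digitValue 3 (1 : ZMod (2 * h + 1) → ℤ) := by
    have := sub_one_mul_digitValue_one (b := 3) (n := 2 * h + 1)
    push_cast
    omega
  have hneg : (N : ℤ) ≡ digitValue 3 (1 : ZMod (2 * h + 1) → ℤ) [ZMOD 3 ^ (2 * h + 1) - 1] := by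
    have hdvd' := Int.natCast_dvd_natCast.2 hdvd
    rw [Nat.cast_sub (Nat.one_le_pow _ _ (by norm_num)), Nat.cast_add, hhalf] at hdvd'
    push_cast at hdvd'
    refine Int.modEq_iff_dvd.2 ((dvd_sub dvd_rfl hdvd').trans (dvd_of_eq ?_))
    linear_combination -sub_one_mul_digitValue_one (b := 3) (n := 2 * h + 1)
  simp only [Nat.cast_add, Nat.cast_pow, Nat.cast_ofNat, Nat.cast_one, one_mul] at hmod
  exact_mod_cast hsum ▸ card_digits_le_sum_digits h hj hk (hmod.symm.trans hneg)

end FrobeniusMultiples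

section Teichmuller

open WittVector
open scoped Pointwise

theorem pow_prime_mem_span {R A : Type*} [CommSemiring R] [CommSemiring A] [Algebra R A] {p : ℕ}
    (hp : p.Prime) {S : Set A} (hS : ∀ f ∈ S, f ^ p ∈ Submodule.span R S)
    (hpS : ∀ f ∈ S ^ p, (p : A) * f ∈ Submodule.span R S) {f : A} (hf : f ∈ Submodule.span R S) :
    f ^ p ∈ Submodule.span R S := by
  have hmul : Submodule.span R S ^ p ≤
      (Submodule.span R S).comap (LinearMap.mulLeft R (p : A)) := by
    rw [Submodule.span_pow, Submodule.span_le]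
    exact hpS
  induction hf using Submodule.span_induction with
  | mem f hf => exact hS f hf
  | zero => simp [hp.ne_zero]
  | smul c f _ ih => rw [smul_pow]; exact Submodule.smul_mem _ _ ih
  | add f g hf hg ihf ihg =>
    rw [add_pow_prime_eq' hp, Finset.mul_sum]
    refine add_mem (add_mem ihf ihg) (sum_mem fun k hk => ?_)
    have hfg : f ^ k * g ^ (p - k) ∈ Submodule.span R S ^ p := by
      rw [← Nat.add_sub_of_le (Finset.mem_Ioo.1 hk).2.le, pow_add, Nat.add_sub_cancel_left]
      exact Submodule.mul_mem_mul (Submodule.pow_mem_pow _ hf _) (Submodule.pow_mem_pow _ hg _)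
    have hpfg : (p : A) * (f ^ k * g ^ (p - k)) ∈ Submodule.span R S := hmul hfg
    rw [← mul_assoc, ← nsmul_eq_mul']
    exact nsmul_mem hpfg _

variable {p : ℕ} [Fact p.Prime] {F : Type*} [Field F] {E : Set ℕ}

variable (p F E) in
/-- The functions `x ↦ p ^ r * τ x ^ N` on `F`, where `τ` is the Teichmüller lift and `τ x ^ N` is a
product of `(p - 1) * r + d` factors `τ x ^ (p ^ i * e)` with `e ∈ E`. The balance between `r` and
the number of factors makes the span of the functions with `d = 1` stable under `f ↦ f ^ p`. -/
def teichmullerMonomials (d : ℕ) : Set (F → WittVector p F) :=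
  {f | ∃ r, ∃ N ∈ ((p - 1) * r + d) • frobeniusMultiples p E,
    f = fun x => (p : WittVector p F) ^ r * teichmuller p x ^ N}

theorem teichmullerMonomials_one_pow_subset (n : ℕ) :
    teichmullerMonomials p F E 1 ^ n ⊆ teichmullerMonomials p F E n := by
  induction n with
  | zero =>
    rw [pow_zero, Set.one_subset]
    exact ⟨0, 0, by simp, by funext x; simp⟩
  | succ n ih =>
    rw [pow_succ]
    rintro _ ⟨f, hf, g, ⟨s, M, hM, rfl⟩, rfl⟩
    obtain ⟨r, N, hN, rfl⟩ := ih hf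
    refine ⟨r + s, N + M, ?_, ?_⟩
    · convert Set.add_mem_add hN hM using 1
      rw [← add_nsmul]
      ring_nf
    · funext x
      simp only [Pi.mul_apply, pow_add]
      ring

theorem natCast_mul_mem_teichmullerMonomials {f : F → WittVector p F}
    (hf : f ∈ teichmullerMonomials p F E p) :
    (p : F → WittVector p F) * f ∈ teichmullerMonomials p F E 1 := by
  obtain ⟨r, N, hN, rfl⟩ := hf
  have hp := (Fact.out : p.Prime).one_le
  have hweight : (p - 1) * r + p = (p - 1) * (r + 1) + 1 := by
    rw [mul_add_one, add_assoc, Nat.sub_add_cancel hp]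
  refine ⟨r + 1, N, hweight ▸ hN, ?_⟩
  funext x
  rw [Pi.mul_apply, Pi.natCast_apply, pow_succ', mul_assoc]

theorem pow_prime_mem_span_teichmullerMonomials {f : F → WittVector p F}
    (hf : f ∈ Submodule.span (WittVector p F) (teichmullerMonomials p F E 1)) :
    f ^ p ∈ Submodule.span (WittVector p F) (teichmullerMonomials p F E 1) := by
  refine pow_prime_mem_span Fact.out ?_ (fun f hf => Submodule.subset_span
    (natCast_mul_mem_teichmullerMonomials (teichmullerMonomials_one_pow_subset p hf))) hf
  rintro _ ⟨r, N, hN, rfl⟩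
  have hfrob : (fun x : F => (p : WittVector p F) ^ r * teichmuller p x ^ N) ^ p =
      ((p : WittVector p F) ^ r) ^ (p - 1) •
        fun x => (p : WittVector p F) ^ r * teichmuller p x ^ (p * N) := by
    funext x
    rw [Pi.pow_apply, Pi.smul_apply, smul_eq_mul, mul_pow, ← mul_assoc, ← pow_succ,
      Nat.sub_add_cancel (Fact.out : p.Prime).one_le, ← pow_mul _ N, mul_comm N]
  rw [hfrob]
  exact Submodule.smul_mem _ _
    (Submodule.subset_span ⟨r, p * N, mul_mem_nsmul_frobeniusMultiples hN, rfl⟩)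

theorem pow_prime_pow_mem_span_teichmullerMonomials {f : F → WittVector p F}
    (hf : f ∈ Submodule.span (WittVector p F) (teichmullerMonomials p F E 1)) (n : ℕ) :
    f ^ p ^ n ∈ Submodule.span (WittVector p F) (teichmullerMonomials p F E 1) := by
  induction n with
  | zero => simpa using hf
  | succ n ih => rw [pow_succ, pow_mul]; exact pow_prime_mem_span_teichmullerMonomials ih

theorem teichmuller_mul_pow_mem_span {e : ℕ} (he : e ∈ E) (c : F) (i : ℕ) :
    (fun x => teichmuller p (c * x ^ e) ^ p ^ i) ∈
      Submodule.span (WittVector p F) (teichmullerMonomials p F E 1) := by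
  have hmonomial : (fun x => teichmuller p (c * x ^ e) ^ p ^ i) =
      teichmuller p c ^ p ^ i •
        fun x => (p : WittVector p F) ^ 0 * teichmuller p x ^ (p ^ i * e) := by
    funext x
    rw [Pi.smul_apply, smul_eq_mul, pow_zero, one_mul, map_mul, map_pow, mul_pow, ← pow_mul,
      mul_comm e]
  rw [hmonomial]
  exact Submodule.smul_mem _ _
    (Submodule.subset_span ⟨0, p ^ i * e, by simpa using ⟨i, e, he, rfl⟩, rfl⟩)

theorem teichmuller_injective : Function.Injective (teichmuller p : F → WittVector p F) :=
  Function.LeftInverse.injective (g := fun z : WittVector p F => z.coeff 0)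
    (teichmuller_coeff_zero p)

theorem teichmuller_neg_one (hp : p ≠ 2) [CharP F p] : teichmuller p (-1 : F) = -1 := by
  have hsq : teichmuller p (-1 : F) ^ 2 = 1 := by rw [← map_pow, neg_one_sq, map_one]
  refine (sq_eq_one_iff.1 hsq).resolve_left fun hone => ?_
  exact Ring.neg_one_ne_one_of_char_ne_two (ringChar.eq F p ▸ hp)
    (teichmuller_injective (hone.trans (map_one _).symm))

theorem teichmuller_intCast (hp : p ≠ 2) [CharP F p] {u : ℤ} (hu : u = 0 ∨ u = 1 ∨ u = -1) :
    teichmuller p (u : F) = u := by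
  rcases hu with rfl | rfl | rfl
  · simp
  · simp
  · simpa using teichmuller_neg_one hp

theorem natCast_dvd_iff_constantCoeff_eq_zero [CharP F p] [PerfectRing F p] (z : WittVector p F) :
    (p : WittVector p F) ∣ z ↔ constantCoeff z = 0 := by
  rw [← RingHom.mem_ker, ker_constantCoeff, Ideal.mem_span_singleton]

theorem pow_dvd_of_pow_dvd_intCast [CharP F p] [PerfectRing F p] {n : ℕ} {M : ℤ}
    (hM : (p : WittVector p F) ^ n ∣ (M : WittVector p F)) : (p : ℤ) ^ n ∣ M := by
  induction n generalizing M with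
  | zero => simp
  | succ n ih =>
    have hcoeff := (natCast_dvd_iff_constantCoeff_eq_zero _).1
      ((dvd_pow_self _ n.succ_ne_zero).trans hM)
    rw [map_intCast] at hcoeff
    obtain ⟨M', rfl⟩ := (CharP.intCast_eq_zero_iff F p M).1 hcoeff
    rw [pow_succ', Int.cast_mul, Int.cast_natCast,
      mul_dvd_mul_iff_left (WittVector.p_nonzero p F)] at hM
    rw [pow_succ']
    exact mul_dvd_mul_left _ (ih hM)

theorem sum_pow_eq_zero_of_injective {R : Type*} [Fintype F] [CommRing R] [IsDomain R] {φ : F →* R}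
    (hφ : Function.Injective φ) {K : ℕ} (hK : ¬ Fintype.card F - 1 ∣ K) : ∑ x, φ x ^ K = 0 := by
  have hK' := mt (FiniteField.forall_pow_eq_one_iff F K).1 hK
  push Not at hK'
  obtain ⟨a, ha⟩ := hK'
  have ha' : φ a ^ K ≠ 1 := fun h => ha <| Units.ext <| hφ <| by simpa using h
  have hinv : φ a ^ K * ∑ x, φ x ^ K = ∑ x, φ x ^ K := by
    rw [Finset.mul_sum]
    exact Fintype.sum_equiv (Equiv.mulLeft₀ (a : F) a.ne_zero) _ _ fun x => by simp [mul_pow]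
  by_contra hne
  exact ha' ((mul_eq_right₀ hne).1 hinv)

theorem teichmuller_algebraMap_pow [Algebra (ZMod p) F] (z : ZMod p) (n : ℕ) :
    teichmuller p (algebraMap (ZMod p) F z) ^ p ^ n = teichmuller p (algebraMap (ZMod p) F z) := by
  rw [← map_pow, ← map_pow, ZMod.pow_card_pow]

theorem exists_teichmuller_trace_approx [Finite F] [Algebra (ZMod p) F]
    {g : Polynomial F} (hg : (g.support : Set ℕ) ⊆ E) :
    ∃ T ∈ Submodule.span (WittVector p F) (teichmullerMonomials p F E 1), ∀ x,
      (p : WittVector p F) ∣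
        teichmuller p (algebraMap (ZMod p) F (Algebra.trace (ZMod p) F (g.eval x))) - T x := by
  have : CharP F p := charP_of_injective_algebraMap (algebraMap (ZMod p) F).injective p
  refine ⟨∑ i ∈ Finset.range (Module.finrank (ZMod p) F), ∑ e ∈ g.support,
    fun x => teichmuller p (g.coeff e * x ^ e) ^ p ^ i,
    sum_mem fun i _ => sum_mem fun e he => teichmuller_mul_pow_mem_span (hg he) _ i, fun x => ?_⟩
  have hcoeff (z : F) : constantCoeff (teichmuller p z) = z := teichmuller_coeff_zero p z
  rw [natCast_dvd_iff_constantCoeff_eq_zero, map_sub, hcoeff, sub_eq_zero,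
    FiniteField.algebraMap_trace_eq_sum_pow, Nat.card_zmod, Polynomial.eval_eq_sum,
    Polynomial.sum_def]
  simp only [Finset.sum_apply, map_sum, map_pow, hcoeff, sum_pow_char_pow]

variable [Fintype F]

theorem pow_dvd_sum_teichmuller_pow_mul [CharP F p] {M s : ℕ}
    (hs : ∀ r N, N ∈ ((p - 1) * r + 1) • frobeniusMultiples p E →
      Fintype.card F - 1 ∣ M + N → s ≤ r) {f : F → WittVector p F}
    (hf : f ∈ Submodule.span (WittVector p F) (teichmullerMonomials p F E 1)) :
    (p : WittVector p F) ^ s ∣ ∑ x, teichmuller p x ^ M * f x := by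
  induction hf using Submodule.span_induction with
  | zero => simp
  | add f g _ _ ihf ihg =>
    simp only [Pi.add_apply, mul_add, Finset.sum_add_distrib]
    exact dvd_add ihf ihg
  | smul c f _ ih =>
    simp only [Pi.smul_apply, smul_eq_mul, mul_left_comm, ← Finset.mul_sum]
    exact ih.mul_left _
  | mem f hf =>
    obtain ⟨r, N, hN, rfl⟩ := hf
    simp only [mul_left_comm _ ((p : WittVector p F) ^ r), ← Finset.mul_sum, ← pow_add]
    by_cases hdvd : Fintype.card F - 1 ∣ M + N
    · exact (pow_dvd_pow _ (hs r N hN hdvd)).mul_right _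
    · rw [sum_pow_eq_zero_of_injective teichmuller_injective hdvd, mul_zero]
      exact dvd_zero _

theorem pow_dvd_sum_teichmuller_pow_mul_trace [Algebra (ZMod p) F] {M s : ℕ}
    (hs : ∀ r N, N ∈ ((p - 1) * r + 1) • frobeniusMultiples p E →
      Fintype.card F - 1 ∣ M + N → s ≤ r) {g : Polynomial F} (hg : (g.support : Set ℕ) ⊆ E) :
    (p : WittVector p F) ^ s ∣ ∑ x, teichmuller p x ^ M *
      teichmuller p (algebraMap (ZMod p) F (Algebra.trace (ZMod p) F (g.eval x))) := by
  have : CharP F p := charP_of_injective_algebraMap (algebraMap (ZMod p) F).injective p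
  obtain ⟨T, hT, hTdvd⟩ := exists_teichmuller_trace_approx (p := p) hg
  have happrox (x : F) : (p : WittVector p F) ^ s ∣
      teichmuller p (algebraMap (ZMod p) F (Algebra.trace (ZMod p) F (g.eval x))) -
        (T ^ p ^ s) x := by
    have h := dvd_sub_pow_of_dvd_sub (hTdvd x) s
    rw [teichmuller_algebraMap_pow] at h
    exact (pow_dvd_pow _ s.le_succ).trans h
  have hmain := pow_dvd_sum_teichmuller_pow_mul hs
    (pow_prime_pow_mem_span_teichmullerMonomials hT s)
  rw [← dvd_sub_left hmain, ← Finset.sum_sub_distrib]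
  simp only [← mul_sub]
  exact Finset.dvd_sum fun x _ => (happrox x).mul_left _

end Teichmuller

section BalancedTrace

open scoped Pointwise

variable {F : Type*} [Field F] [Algebra (ZMod 3) F]

/-- The trace to `ZMod 3` lifted to `{-1, 0, 1} ⊆ ℤ`. This lift is chosen because it is odd and is
compatible with Teichmüller representatives. -/
noncomputable def balancedTrace (z : F) : ℤ :=
  (Algebra.trace (ZMod 3) F z).valMinAbs

theorem balancedTrace_eq_zero_or (z : F) :
    balancedTrace z = 0 ∨ balancedTrace z = 1 ∨ balancedTrace z = -1 := by
  have hlift : ∀ a : ZMod 3, a.valMinAbs = 0 ∨ a.valMinAbs = 1 ∨ a.valMinAbs = -1 := by decide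
  exact hlift _

theorem balancedTrace_neg (z : F) : balancedTrace (-z) = -balancedTrace z := by
  have hlift : ∀ a : ZMod 3, (-a).valMinAbs = -a.valMinAbs := by decide
  rw [balancedTrace, map_neg, hlift, balancedTrace]

theorem algebraMap_trace_eq_balancedTrace (z : F) :
    algebraMap (ZMod 3) F (Algebra.trace (ZMod 3) F z) = balancedTrace z := by
  rw [← map_intCast (algebraMap (ZMod 3) F), balancedTrace, ZMod.coe_valMinAbs]

variable [Fintype F] [DecidableEq F]

theorem three_pow_dvd_sum_quadraticChar_mul_balancedTrace {h : ℕ}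
    (hF : Fintype.card F = 3 ^ (2 * h + 1)) (c₁ c₂ : F) :
    (3 : ℤ) ^ h ∣
      ∑ x, quadraticChar F x * balancedTrace (c₁ * x ^ (3 ^ (h + 1) + 2) + c₂ * x) := by
  have : CharP F 3 := charP_of_injective_algebraMap (algebraMap (ZMod 3) F).injective 3
  have hthree : (3 : ℕ) ≠ 2 := by norm_num
  have hchar (x : F) : WittVector.teichmuller 3 x ^ (Fintype.card F / 2) = quadraticChar F x := by
    rw [← map_pow, ← quadraticChar_eq_pow_of_char_ne_two' (ringChar.eq F 3 ▸ hthree),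
      teichmuller_intCast hthree (quadraticChar_isQuadratic F x)]
  have hweight (r N : ℕ)
      (hN : N ∈ ((3 - 1) * r + 1) • frobeniusMultiples 3 {3 ^ (h + 1) + 2, 1})
      (hdvd : Fintype.card F - 1 ∣ Fintype.card F / 2 + N) : h ≤ r := by
    rw [hF] at hdvd
    have := le_of_mem_nsmul_frobeniusMultiples hN hdvd
    omega
  have hsupport : (((Polynomial.C c₁ * Polynomial.X ^ (3 ^ (h + 1) + 2) +
      Polynomial.C c₂ * Polynomial.X ^ 1).support : Finset ℕ) : Set ℕ) ⊆
        {3 ^ (h + 1) + 2, 1} := by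
    rw [← Finset.coe_pair, Finset.coe_subset]
    exact Polynomial.support_binomial_subset _ _ _ _
  have hsum := pow_dvd_sum_teichmuller_pow_mul_trace (p := 3) hweight hsupport
  simp only [hchar, algebraMap_trace_eq_balancedTrace,
    teichmuller_intCast hthree (balancedTrace_eq_zero_or _), Polynomial.eval_add,
    Polynomial.eval_mul, Polynomial.eval_C, Polynomial.eval_pow, Polynomial.eval_X, pow_one,
    ← Int.cast_mul, ← Int.cast_sum] at hsum
  exact_mod_cast pow_dvd_of_pow_dvd_intCast hsum

end BalancedTrace

section ReeTits

variable {F : Type*} [Field F] {σ : F →+* F}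

theorem exists_sq_eq_of_map_eq_sq (hσ : ∀ x, σ (σ x) = x ^ 3) {w d : F} (hw : σ w = d ^ 2) :
    ∃ g, g ^ 2 = w ∧ σ g = d := by
  rcases eq_or_ne w 0 with rfl | hw0
  · exact ⟨0, by simp, by simpa [eq_comm (a := (0 : F))] using hw⟩
  · have hcube : σ d ^ 2 = w ^ 3 := by rw [← map_pow, ← hw, hσ]
    have hd : d ≠ 0 := by
      rintro rfl
      simp [hw0] at hw
    refine ⟨σ d / w, ?_, ?_⟩
    · rw [div_pow, hcube]; field_simp
    · rw [map_div₀, hσ, hw]; field_simp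

variable [CharP F 3]

theorem eq_or_eq_neg_one_of_reeTits_system (hσ : ∀ x, σ (σ x) = x ^ 3) {ρ μ : F} (hρ : ρ ≠ 0)
    (hσρ : σ ρ = -1 - ρ * μ ^ 2) (hσμ : σ (ρ * μ) = 1 - ρ * μ * (ρ + μ)) : ρ = μ ∨ μ = -1 := by
  have hcube : ρ ^ 3 * σ ρ = -σ ρ - σ (ρ * μ) ^ 2 := by
    have hprod : ρ * σ ρ = -ρ - (ρ * μ) ^ 2 := by rw [hσρ]; ring
    simpa only [map_mul, map_sub, map_neg, map_pow, hσ, mul_comm] using congrArg σ hprod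
  have hfactor : ρ ^ 2 * ((ρ - μ) * (1 + μ) ^ 3) = 0 := by
    rw [hσμ, hσρ] at hcube
    grind
  simpa [hρ, sub_eq_zero, add_comm (1 : F), add_eq_zero_iff_eq_neg] using hfactor

theorem reeTits_system_false (hσ : ∀ x, σ (σ x) = x ^ 3) {ρ μ : F} (hρ : ρ ≠ 0)
    (hσρ : σ ρ = -1 - ρ * μ ^ 2) (hσμ : σ (ρ * μ) = 1 - ρ * μ * (ρ + μ)) : False := by
  have hσρ0 : σ ρ ≠ 0 := by simpa using hρ
  rcases eq_or_eq_neg_one_of_reeTits_system hσ hρ hσρ hσμ with rfl | rfl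
  · rw [map_mul] at hσμ
    have hone : σ ρ = -1 := by
      apply mul_left_cancel₀ hσρ0
      grind
    exact pow_ne_zero 3 hρ (by linear_combination hσρ - hone)
  · grind

theorem reeTits_factor_ne_zero (hσ : ∀ x, σ (σ x) = x ^ 3) {g r : F}
    (hg : σ g - g ^ 2 = r * σ r - r ^ 2 - 1) : (r + 1) * (σ r + g + r) + g ^ 2 ≠ 0 := by
  intro hzero
  obtain ⟨ρ, rfl⟩ : ∃ ρ, r = ρ - 1 := ⟨r + 1, by ring⟩
  rw [map_sub, map_one] at hg hzero
  have hρ : ρ ≠ 0 := by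
    rintro rfl
    have hg0 : g = 0 := by simpa using hzero
    subst hg0
    simp at hg
  obtain ⟨μ, rfl⟩ : ∃ μ, g = ρ * (μ + 1) := ⟨g / ρ - 1, by field_simp; ring⟩
  have hσρ : σ ρ = -1 - ρ * μ ^ 2 := by
    apply mul_left_cancel₀ hρ
    grind
  refine reeTits_system_false hσ hρ hσρ ?_
  rw [mul_add_one, map_add, hσρ] at hg
  grind

theorem reeTits_ne (hσ : ∀ x, σ (σ x) = x ^ 3) (g r : F) :
    σ g - g ^ 2 ≠ r * σ r - r ^ 2 - 1 := by
  intro hg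
  have hσg := congrArg σ hg
  simp only [map_sub, map_mul, map_pow, map_one, hσ] at hσg
  -- Eliminating `σ g` from `hg` and `hσg` leaves a product of two factors swapped by `r ↦ -r`.
  have hfactor : ((r + 1) * (σ r + g + r) + g ^ 2) *
      ((-r + 1) * (σ (-r) + g + -r) + g ^ 2) = 0 := by
    rw [map_neg]
    rw [sub_eq_iff_eq_add] at hg
    rw [hg] at hσg
    grind
  rcases mul_eq_zero.1 hfactor with hzero | hzero
  · exact reeTits_factor_ne_zero hσ hg hzero
  · exact reeTits_factor_ne_zero hσ (by rw [map_neg]; linear_combination hg) hzero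

theorem reeTits_injective (hσ : ∀ x, σ (σ x) = x ^ 3) (b : F) :
    Function.Injective fun x => σ x ^ 2 * x ^ 3 + σ b * σ x - b ^ 2 * x := by
  intro x y hxy
  by_contra hne
  obtain ⟨u, v, rfl, rfl⟩ : ∃ u v, x = u + v ∧ y = u - v :=
    ⟨-(x + y), y - x, by grind, by grind⟩
  have hv : v ≠ 0 := by rintro rfl; simp at hne
  have hσv : σ v ≠ 0 := by simpa using hv
  have hdiff : (σ u ^ 2 + σ v ^ 2) * v ^ 3 - σ u * σ v * u ^ 3 + σ b * σ v - b ^ 2 * v = 0 := by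
    simp only [map_add, map_sub] at hxy
    grind
  let r := u / v
  let d := b / (v * σ v)
  have hw : σ (d - (r * σ r - r ^ 2 - 1)) = d ^ 2 := by
    simp only [d, r, map_sub, map_mul, map_div₀, map_pow, map_one, hσ]
    field_simp
    linear_combination hdiff
  obtain ⟨g, hg, hσg⟩ := exists_sq_eq_of_map_eq_sq hσ hw
  exact reeTits_ne hσ g r (by rw [hg, hσg, sub_sub_cancel])

end ReeTits

section Characters

theorem sum_mul_sum_neg_of_injective {F R ι : Type*} [Field F] [Fintype F] [CommRing R] [IsDomain R]
    [Fintype ι] {ψ : AddChar F R} (hψ : ψ ≠ 1) {f : ι → F} (hf : Function.Injective f) (w : ι → R) :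
    ∑ γ, (∑ x, w x * ψ (γ * f x)) * ∑ x, w x * ψ (-γ * f x) =
      Fintype.card F * ∑ x, w x ^ 2 := by
  classical
  have hexpand (γ : F) : (∑ x, w x * ψ (γ * f x)) * ∑ x, w x * ψ (-γ * f x) =
      ∑ x, ∑ y, w x * w y * ψ (γ * (f x - f y)) := by
    rw [Finset.sum_mul_sum]
    refine Finset.sum_congr rfl fun x _ => Finset.sum_congr rfl fun y _ => ?_
    rw [mul_sub, sub_eq_add_neg, ← neg_mul, AddChar.map_add_eq_mul]
    ring
  have horth (x y : ι) : ∑ γ, ψ (γ * (f x - f y)) = if x = y then (Fintype.card F : R) else 0 := by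
    rw [AddChar.sum_mulShift _ (AddChar.IsPrimitive.of_ne_one hψ)]
    simp only [sub_eq_zero, hf.eq_iff, Nat.cast_ite, Nat.cast_zero]
  simp only [hexpand]
  rw [Finset.sum_comm, Finset.mul_sum]
  refine Finset.sum_congr rfl fun x _ => ?_
  rw [Finset.sum_comm]
  simp only [← Finset.mul_sum, horth, mul_ite, mul_zero, Finset.sum_ite_eq, Finset.mem_univ,
    if_true]
  ring

variable (p : ℕ) [Fact p.Prime] (F : Type*) [Field F] [Algebra (ZMod p) F]

/-- The canonical additive character `z ↦ exp (2 π i Tr z / p)`. -/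
noncomputable def traceChar : AddChar F ℂ :=
  ZMod.stdAddChar.compAddMonoidHom (Algebra.trace (ZMod p) F).toAddMonoidHom

variable {F} in
theorem exp_pow_val_eq_traceChar (z : F) :
    Complex.exp (2 * (Real.pi : ℂ) * Complex.I / p) ^ (Algebra.trace (ZMod p) F z).val =
      traceChar p F z := by
  have hval := ZMod.stdAddChar_coe (N := p) ((Algebra.trace (ZMod p) F z).val : ℤ)
  rw [Int.cast_natCast, ZMod.natCast_zmod_val] at hval
  rw [traceChar, AddChar.compAddMonoidHom_apply, LinearMap.toAddMonoidHom_coe, hval,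
    ← Complex.exp_nat_mul]
  congr 1
  push_cast
  ring

theorem traceChar_ne_one [Finite F] : traceChar p F ≠ 1 := by
  intro hone
  obtain ⟨z, hz⟩ := Algebra.trace_surjective (ZMod p) F 1
  have hz' := DFunLike.congr_fun hone z
  rw [traceChar, AddChar.compAddMonoidHom_apply, LinearMap.toAddMonoidHom_coe, hz,
    AddChar.one_apply, ← AddChar.map_zero_eq_one (ZMod.stdAddChar (N := p))] at hz'
  exact one_ne_zero (ZMod.injective_stdAddChar hz')

end Characters

section QuadraticChar

variable {F : Type*} [Field F] [Fintype F] [DecidableEq F]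

theorem quadraticChar_odd (hF : Fintype.card F % 4 = 3) : Function.Odd (quadraticChar F) := by
  intro x
  have hneg_one : quadraticChar F (-1) = -1 := by
    rw [quadraticChar_neg_one_iff_not_isSquare, FiniteField.isSquare_neg_one_iff, not_not]
    exact hF
  rw [neg_eq_neg_one_mul, map_mul, hneg_one, neg_one_mul]

theorem sum_quadraticChar_sq : ∑ x, quadraticChar F x ^ 2 = (Fintype.card F : ℤ) - 1 := by
  simp only [← MulChar.pow_apply' _ two_ne_zero, (quadraticChar_isQuadratic F).sq_eq_one,
    MulChar.sum_one_eq_card_units, Fintype.card_units, Nat.cast_pred Fintype.card_pos]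

theorem sum_units_quadraticChar_mul {R : Type*} [CommRing R] (g : F → R) :
    ∑ x : Fˣ, (quadraticChar F (x : F) : R) * g x = ∑ x, (quadraticChar F x : R) * g x := by
  refine Finset.sum_of_injOn Units.val Units.val_injective.injOn (by simp) ?_ fun _ _ => rfl
  intro x _ hx
  obtain rfl : x = 0 := by
    by_contra hne
    exact hx ⟨Units.mk0 x hne, by simp, rfl⟩
  simp

end QuadraticChar

section CharTraceSum

variable {F : Type*} [Field F] [Algebra (ZMod 3) F]

theorem exp_two_pi_mul_I_div_three :
    Complex.exp (2 * (Real.pi : ℂ) * Complex.I / 3) = -1 / 2 + Complex.I * (√(3 : ℝ) : ℂ) / 2 := by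
  have harg : 2 * (Real.pi : ℂ) * Complex.I / 3 =
      ((Real.pi - Real.pi / 3 : ℝ) : ℂ) * Complex.I := by
    push_cast
    ring
  rw [harg, Complex.exp_mul_I, ← Complex.ofReal_cos, ← Complex.ofReal_sin, Real.cos_pi_sub,
    Real.sin_pi_sub, Real.cos_pi_div_three, Real.sin_pi_div_three]
  push_cast
  ring

theorem I_mul_sqrt_three_sq : (Complex.I * (√(3 : ℝ) : ℂ)) ^ 2 = -3 := by
  rw [mul_pow, Complex.I_sq, ← Complex.ofReal_pow, Real.sq_sqrt (by norm_num)]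
  norm_num

theorem traceChar_three_eq (z : F) :
    traceChar 3 F z = 1 + Complex.I * (√(3 : ℝ) : ℂ) / 2 * (balancedTrace z : ℂ) -
      3 / 2 * (balancedTrace z : ℂ) ^ 2 := by
  have hlift : ∀ a : ZMod 3, (a.val = 0 ∧ a.valMinAbs = 0) ∨ (a.val = 1 ∧ a.valMinAbs = 1) ∨
    (a.val = 2 ∧ a.valMinAbs = -1) := by decide
  rw [← exp_pow_val_eq_traceChar, Nat.cast_ofNat, exp_two_pi_mul_I_div_three, balancedTrace]
  rcases hlift (Algebra.trace (ZMod 3) F z) with ⟨h, h'⟩ | ⟨h, h'⟩ | ⟨h, h'⟩ <;> rw [h, h']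
  · simp
  · push_cast; ring
  · push_cast
    linear_combination I_mul_sqrt_three_sq / 4

theorem ringChar_ne_two : ringChar F ≠ 2 := by
  have : CharP F 3 := charP_of_injective_algebraMap (algebraMap (ZMod 3) F).injective 3
  rw [ringChar.eq F 3]
  norm_num

theorem balancedTrace_comp_odd {f : F → F} (hf : Function.Odd f) (γ : F) :
    Function.Odd fun x => balancedTrace (γ * f x) :=
  fun x => by simp only [hf x, mul_neg, balancedTrace_neg]

variable [Fintype F]

theorem three_mul_sum_balancedTrace_sq :
    3 * ∑ z : F, balancedTrace z ^ 2 = 2 * Fintype.card F := by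
  have hchar : ∑ z : F, traceChar 3 F z = 0 :=
    AddChar.sum_eq_zero_of_ne_one (traceChar_ne_one 3 F)
  have hodd : ∑ z : F, (balancedTrace z : ℂ) = 0 := by
    exact_mod_cast Function.Odd.sum_eq_zero (balancedTrace_neg (F := F))
  simp only [traceChar_three_eq, Finset.sum_add_distrib, Finset.sum_sub_distrib, ← Finset.mul_sum,
    hodd, Finset.sum_const, Finset.card_univ, nsmul_eq_mul, mul_one, mul_zero, add_zero] at hchar
  have hsum : (3 : ℂ) * ∑ z : F, (balancedTrace z : ℂ) ^ 2 = 2 * Fintype.card F := by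
    linear_combination -2 * hchar
  exact_mod_cast hsum

variable [DecidableEq F] {f : F → F}

/-- The integer `T` such that, for odd `f` and `card F % 4 = 3`, the character sum
`∑ x, χ x * exp (2 π i Tr (γ * f x) / 3)` equals `(i √3 / 2) * T`. -/
noncomputable def charTraceSum (f : F → F) (γ : F) : ℤ :=
  ∑ x, quadraticChar F x * balancedTrace (γ * f x)

theorem sum_quadraticChar_mul_traceChar (hF : Fintype.card F % 4 = 3) (hf : Function.Odd f)
    (γ : F) : ∑ x, (quadraticChar F x : ℂ) * traceChar 3 F (γ * f x) =
      Complex.I * (√(3 : ℝ) : ℂ) / 2 * (charTraceSum f γ : ℂ) := by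
  have hχ : ∑ x : F, (quadraticChar F x : ℂ) = 0 := by
    exact_mod_cast quadraticChar_sum_zero (F := F) ringChar_ne_two
  have hodd : ∑ x : F, (quadraticChar F x : ℂ) * (balancedTrace (γ * f x) : ℂ) ^ 2 = 0 := by
    have heven : Function.Even fun x => balancedTrace (γ * f x) ^ 2 := fun x => by
      simp only [balancedTrace_comp_odd hf γ x, neg_sq]
    exact_mod_cast ((quadraticChar_odd hF).mul_even heven).sum_eq_zero
  have hterm (x : F) : (quadraticChar F x : ℂ) * traceChar 3 F (γ * f x) = quadraticChar F x +
      Complex.I * (√(3 : ℝ) : ℂ) / 2 * ((quadraticChar F x : ℂ) * (balancedTrace (γ * f x) : ℂ)) -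
      3 / 2 * ((quadraticChar F x : ℂ) * (balancedTrace (γ * f x) : ℂ) ^ 2) := by
    rw [traceChar_three_eq]
    ring
  simp only [hterm, Finset.sum_add_distrib, Finset.sum_sub_distrib, ← Finset.mul_sum, hχ, hodd,
    charTraceSum]
  push_cast
  ring

theorem charTraceSum_neg (γ : F) : charTraceSum f (-γ) = -charTraceSum f γ := by
  simp only [charTraceSum, neg_mul, balancedTrace_neg, mul_neg, Finset.sum_neg_distrib]

theorem three_mul_sum_charTraceSum_sq (hF : Fintype.card F % 4 = 3) (hf : Function.Odd f)
    (hinj : Function.Injective f) :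
    3 * ∑ γ : F, charTraceSum f γ ^ 2 = 4 * (Fintype.card F * (Fintype.card F - 1)) := by
  have hparseval := sum_mul_sum_neg_of_injective (traceChar_ne_one 3 F) hinj
    fun x => (quadraticChar F x : ℂ)
  have hterm (γ : F) : (∑ x, (quadraticChar F x : ℂ) * traceChar 3 F (γ * f x)) *
      ∑ x, (quadraticChar F x : ℂ) * traceChar 3 F (-γ * f x) =
        3 / 4 * (charTraceSum f γ : ℂ) ^ 2 := by
    simp only [sum_quadraticChar_mul_traceChar hF hf, charTraceSum_neg]
    push_cast
    linear_combination -(charTraceSum f γ : ℂ) ^ 2 / 4 * I_mul_sqrt_three_sq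
  have hsq : ∑ x : F, (quadraticChar F x : ℂ) ^ 2 = Fintype.card F - 1 := by
    exact_mod_cast congrArg (Int.cast : ℤ → ℂ) (sum_quadraticChar_sq (F := F))
  simp only [hterm, ← Finset.mul_sum, hsq] at hparseval
  have hsum : (3 : ℂ) * ∑ γ : F, (charTraceSum f γ : ℂ) ^ 2 =
      4 * (Fintype.card F * (Fintype.card F - 1)) := by
    linear_combination 4 * hparseval
  exact_mod_cast hsum

theorem charTraceSum_modEq_sum_sq (hF : Fintype.card F % 4 = 3) (hf : Function.Odd f) (γ : F) :
    charTraceSum f γ ≡ ∑ x, balancedTrace (γ * f x) ^ 2 [ZMOD 4] := by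
  have hzero : balancedTrace (γ * f 0) = 0 := (balancedTrace_comp_odd hf γ).map_zero
  have hneg (x : F) : balancedTrace (γ * f (-x)) = -balancedTrace (γ * f x) :=
    balancedTrace_comp_odd hf γ x
  have hsum : ∑ x, ((quadraticChar F x * balancedTrace (γ * f x) -
      balancedTrace (γ * f x) ^ 2 : ℤ) : ZMod 4) = 0 := by
    refine Finset.sum_ninvolution (fun x => -x) (fun x => ?_) (fun x hx hfix => ?_)
      (fun _ => Finset.mem_univ _) neg_neg
    · rw [quadraticChar_odd hF x, hneg x]
      rcases eq_or_ne x 0 with rfl | hx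
      · simp [hzero]
      · rcases quadraticChar_dichotomy hx with h | h <;>
        rcases balancedTrace_eq_zero_or (γ * f x) with h' | h' | h' <;> rw [h, h'] <;> decide
    · obtain rfl : x = 0 := (Ring.eq_self_iff_eq_zero_of_char_ne_two ringChar_ne_two).1 hfix
      simp [hzero] at hx
  rw [← Int.cast_sum, Finset.sum_sub_distrib, Int.cast_sub, sub_eq_zero] at hsum
  exact (ZMod.intCast_eq_intCast_iff _ _ 4).1 hsum

theorem charTraceSum_emod_four (hF : Fintype.card F % 4 = 3) (hf : Function.Odd f)
    (hinj : Function.Injective f) {γ : F} (hγ : γ ≠ 0) : charTraceSum f γ % 4 = 2 := by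
  have hbij : Function.Bijective fun x => γ * f x :=
    Finite.injective_iff_bijective.1 ((mul_right_injective₀ hγ).comp hinj)
  have hsum := three_mul_sum_balancedTrace_sq (F := F)
  rw [← hbij.sum_comp] at hsum
  have hmod := charTraceSum_modEq_sum_sq hF hf γ
  rw [Int.ModEq] at hmod
  omega

theorem two_mul_three_pow_sq_le_charTraceSum_sq {h : ℕ} (hF : Fintype.card F % 4 = 3)
    (hf : Function.Odd f) (hinj : Function.Injective f) {γ : F} (hγ : γ ≠ 0)
    (hdvd : 3 ^ h ∣ charTraceSum f γ) : (2 * 3 ^ h) ^ 2 ≤ charTraceSum f γ ^ 2 := by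
  have hmod := charTraceSum_emod_four hF hf hinj hγ
  have hcoprime : IsCoprime (2 : ℤ) (3 ^ h) := IsCoprime.pow_right ⟨-1, 1, by norm_num⟩
  have hdvd' : 2 * 3 ^ h ∣ charTraceSum f γ := hcoprime.mul_dvd (by omega) hdvd
  rw [sq_le_sq]
  exact Int.le_of_dvd (abs_pos.2 (by omega)) ((abs_dvd_abs _ _).2 hdvd')

theorem three_pow_odd_mod_four (h : ℕ) : 3 ^ (2 * h + 1) % 4 = 3 := by
  rw [pow_succ, pow_mul]
  norm_num [Nat.mul_mod, Nat.pow_mod]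

theorem charTraceSum_eq_or_eq_neg {h : ℕ} (hF : Fintype.card F = 3 ^ (2 * h + 1))
    (hf : Function.Odd f) (hinj : Function.Injective f) (hdvd : ∀ γ, 3 ^ h ∣ charTraceSum f γ)
    {γ : F} (hγ : γ ≠ 0) :
    charTraceSum f γ = 2 * 3 ^ h ∨ charTraceSum f γ = -(2 * 3 ^ h) := by
  have hF' : Fintype.card F % 4 = 3 := hF ▸ three_pow_odd_mod_four h
  have hzero : charTraceSum f 0 ^ 2 = 0 := by simp [charTraceSum, balancedTrace]
  have hle : ∀ γ ∈ Finset.univ.erase (0 : F), (2 * 3 ^ h) ^ 2 ≤ charTraceSum f γ ^ 2 :=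
    fun γ hγ => two_mul_three_pow_sq_le_charTraceSum_sq hF' hf hinj (Finset.ne_of_mem_erase hγ)
      (hdvd γ)
  have hsum : ∑ _γ ∈ Finset.univ.erase (0 : F), ((2 * 3 ^ h) ^ 2 : ℤ) =
      ∑ γ ∈ Finset.univ.erase 0, charTraceSum f γ ^ 2 := by
    have hsq := three_mul_sum_charTraceSum_sq hF' hf hinj
    have hpow : (3 : ℤ) ^ (2 * h + 1) = 3 * (3 ^ h) ^ 2 := by ring
    rw [Finset.sum_erase (f := fun γ => charTraceSum f γ ^ 2) _ hzero, Finset.sum_const,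
      Finset.card_erase_of_mem (Finset.mem_univ _), Finset.card_univ, nsmul_eq_mul,
      Nat.cast_pred Fintype.card_pos]
    rw [hF] at hsq ⊢
    push_cast [hpow] at hsq ⊢
    linarith
  have heq := (Finset.sum_eq_sum_iff_of_le hle).1 hsum γ
    (Finset.mem_erase.2 ⟨hγ, Finset.mem_univ _⟩)
  exact sq_eq_sq_iff_eq_or_eq_neg.1 heq.symm

end CharTraceSum

section ReeTitsMap

theorem trace_pow_prime_pow {p : ℕ} [Fact p.Prime] {F : Type*} [Field F] [Finite F]
    [Algebra (ZMod p) F] (z : F) (n : ℕ) :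
    Algebra.trace (ZMod p) F (z ^ p ^ n) = Algebra.trace (ZMod p) F z := by
  induction n with
  | zero => rw [pow_zero, pow_one]
  | succ n ih =>
    rw [pow_succ, pow_mul, ← ih,
      ← Algebra.trace_eq_of_algEquiv (FiniteField.frobeniusAlgEquivOfAlgebraic (ZMod p) F)
        (z ^ p ^ n), FiniteField.coe_frobeniusAlgEquivOfAlgebraic, ZMod.card]

theorem sqrt_three_pow_odd (h : ℕ) :
    √((3 ^ (2 * h + 1) : ℕ) : ℝ) = √(3 : ℝ) * 3 ^ h := by
  rw [pow_succ', mul_comm 2, pow_mul, Nat.cast_mul, Nat.cast_ofNat, Real.sqrt_mul zero_le_three,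
    Nat.cast_pow, Real.sqrt_sq (Nat.cast_nonneg _), Nat.cast_pow, Nat.cast_ofNat]

variable {F : Type*} [Field F]

/-- The map `x ↦ x ^ (2 σ + 3) + (b x) ^ σ - b ^ 2 x` of the field with `3 ^ (2 h + 1)` elements,
where `σ = 3 ^ (h + 1)`. Its trace is that of `x ^ (σ + 2) + (b - b ^ 2) x`, but unlike the latter
it permutes the field. -/
def reeTitsMap (h : ℕ) (b x : F) : F :=
  (x ^ 3 ^ (h + 1)) ^ 2 * x ^ 3 + b ^ 3 ^ (h + 1) * x ^ 3 ^ (h + 1) - b ^ 2 * x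

theorem reeTitsMap_odd (h : ℕ) (b : F) : Function.Odd (reeTitsMap h b) := by
  intro x
  have hthree : Odd 3 := by decide
  simp only [reeTitsMap, (hthree.pow (n := h + 1)).neg_pow, hthree.neg_pow]
  ring

variable [Fintype F] {h : ℕ}

theorem pow_three_pow_three_pow (hF : Fintype.card F = 3 ^ (2 * h + 1)) (z : F) :
    (z ^ 3 ^ (h + 1)) ^ 3 ^ (h + 1) = z ^ 3 := by
  have hexp : 3 ^ (h + 1) * 3 ^ (h + 1) = Fintype.card F * 3 := by rw [hF]; ring
  rw [← pow_mul, hexp, pow_mul, FiniteField.pow_card]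

variable [Algebra (ZMod 3) F]

theorem reeTitsMap_injective (hF : Fintype.card F = 3 ^ (2 * h + 1)) (b : F) :
    Function.Injective (reeTitsMap h b) := by
  have : CharP F 3 := charP_of_injective_algebraMap (algebraMap (ZMod 3) F).injective 3
  have hσ (x : F) : iterateFrobenius F 3 (h + 1) (iterateFrobenius F 3 (h + 1) x) = x ^ 3 := by
    rw [iterateFrobenius_def, iterateFrobenius_def, pow_three_pow_three_pow hF]
  exact reeTits_injective hσ b

theorem trace_mul_reeTitsMap (hF : Fintype.card F = 3 ^ (2 * h + 1)) (b γ x : F) :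
    Algebra.trace (ZMod 3) F (γ * reeTitsMap h b x) = Algebra.trace (ZMod 3) F
      (γ ^ 3 ^ h * x ^ (3 ^ (h + 1) + 2) + (γ ^ 3 ^ h * b - γ * b ^ 2) * x) := by
  have : CharP F 3 := charP_of_injective_algebraMap (algebraMap (ZMod 3) F).injective 3
  have hfrob (z : F) : (z ^ 3 ^ h) ^ 3 ^ (h + 1) = z := by
    have hexp : 3 ^ h * 3 ^ (h + 1) = Fintype.card F := by rw [hF]; ring
    rw [← pow_mul, hexp, FiniteField.pow_card]
  have hpow : γ * ((x ^ 3 ^ (h + 1)) ^ 2 * x ^ 3 + b ^ 3 ^ (h + 1) * x ^ 3 ^ (h + 1)) =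
      (γ ^ 3 ^ h * x ^ (3 ^ (h + 1) + 2) + γ ^ 3 ^ h * b * x) ^ 3 ^ (h + 1) := by
    rw [add_pow_char_pow, mul_pow, mul_pow, mul_pow, hfrob, pow_add x, mul_pow,
      pow_three_pow_three_pow hF]
    ring
  calc Algebra.trace (ZMod 3) F (γ * reeTitsMap h b x)
    _ = Algebra.trace (ZMod 3) F (γ ^ 3 ^ h * x ^ (3 ^ (h + 1) + 2) + γ ^ 3 ^ h * b * x) -
        Algebra.trace (ZMod 3) F (γ * b ^ 2 * x) := by
      rw [reeTitsMap, mul_sub, ← mul_assoc γ (b ^ 2), map_sub, hpow, trace_pow_prime_pow]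
    _ = _ := by rw [← map_sub, sub_mul, add_sub_assoc]

variable [DecidableEq F]

theorem three_pow_dvd_charTraceSum_reeTitsMap (hF : Fintype.card F = 3 ^ (2 * h + 1)) (b γ : F) :
    3 ^ h ∣ charTraceSum (reeTitsMap h b) γ := by
  simp only [charTraceSum, balancedTrace, trace_mul_reeTitsMap hF]
  exact three_pow_dvd_sum_quadraticChar_mul_balancedTrace hF _ _

theorem sum_quadraticChar_mul_traceChar_eq_or (hF : Fintype.card F = 3 ^ (2 * h + 1)) (b : F) :
    (∑ x, (quadraticChar F x : ℂ) * traceChar 3 F (x ^ (3 ^ (h + 1) + 2) + (b - b ^ 2) * x) =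
      Complex.I * (√((3 ^ (2 * h + 1) : ℕ) : ℝ) : ℂ)) ∨
    (∑ x, (quadraticChar F x : ℂ) * traceChar 3 F (x ^ (3 ^ (h + 1) + 2) + (b - b ^ 2) * x) =
      -(Complex.I * (√((3 ^ (2 * h + 1) : ℕ) : ℝ) : ℂ))) := by
  have hodd := reeTitsMap_odd h b
  have htrace (x : F) : traceChar 3 F (x ^ (3 ^ (h + 1) + 2) + (b - b ^ 2) * x) =
      traceChar 3 F (1 * reeTitsMap h b x) := by
    rw [← exp_pow_val_eq_traceChar, ← exp_pow_val_eq_traceChar, trace_mul_reeTitsMap hF, one_pow,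
      one_mul, one_mul, one_mul]
  have hsum := sum_quadraticChar_mul_traceChar (hF ▸ three_pow_odd_mod_four h) hodd 1
  simp only [htrace, hsum, sqrt_three_pow_odd]
  refine (charTraceSum_eq_or_eq_neg hF hodd (reeTitsMap_injective hF b)
    (three_pow_dvd_charTraceSum_reeTitsMap hF b) one_ne_zero).imp (fun hT => ?_) fun hT => ?_ <;>
  · rw [hT]
    push_cast
    ring

end ReeTitsMap

theorem corollary3p4 {F : Type*} [Field F] [Fintype F] [DecidableEq F] [Algebra (ZMod 3) F]
    (h q α : ℕ) (hq : q = 3 ^ (2 * h + 1)) (hα : α = 3 ^ (h + 1))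
    (hF : Fintype.card F = q) (a β : F) (ha : a ≠ 0) (hβ : β ≠ 0) :
    (∑ x : Fˣ, (quadraticChar F (x : F) : ℂ) *
        Complex.exp (2 * (Real.pi : ℂ) * Complex.I / 3) ^
          (Algebra.trace (ZMod 3) F
            ((x : F) ^ (α + 2) +
              (β ^ (α - 1) * a ^ α - β ^ (2 * (α - 1)) * a ^ (2 * α)) * (x : F))).val
      = Complex.I * (√(q : ℝ) : ℂ)) ∨
    (∑ x : Fˣ, (quadraticChar F (x : F) : ℂ) *
        Complex.exp (2 * (Real.pi : ℂ) * Complex.I / 3) ^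
          (Algebra.trace (ZMod 3) F
            ((x : F) ^ (α + 2) +
              (β ^ (α - 1) * a ^ α - β ^ (2 * (α - 1)) * a ^ (2 * α)) * (x : F))).val
      = -(Complex.I * (√(q : ℝ) : ℂ))) := by
  subst hq hα
  set b := β ^ (3 ^ (h + 1) - 1) * a ^ 3 ^ (h + 1) with hb
  have hsq : β ^ (2 * (3 ^ (h + 1) - 1)) * a ^ (2 * 3 ^ (h + 1)) = b ^ 2 := by rw [hb]; ring
  have hsum := sum_units_quadraticChar_mul fun x : F =>
    traceChar 3 F (x ^ (3 ^ (h + 1) + 2) + (b - b ^ 2) * x)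
  simp only [← exp_pow_val_eq_traceChar, Nat.cast_ofNat] at hsum
  rw [hsq, hsum]
  simpa only [← exp_pow_val_eq_traceChar, Nat.cast_ofNat] using
    sum_quadraticChar_mul_traceChar_eq_or hF b
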